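/- **Theorem 3.** Consider the following online envy minimization problem with two players. Let $D_1, D_2$ be probability distributions on $[0,1]$ and let $n$ items have values $v^i_j\sim D_i$ ($i\in\{1,2\}$, $1\le j\le n$), all $2n$ values being independent. The algorithm knows $n$ and may evaluate $D_i((-\infty,x])$ and $D_i((-\infty,x))$ for real numbers $x$. The items arrive one by one; when item $j$ arrives, its values $v^1_j, v^2_j$ are revealed and the item must be given immediately and irrevocably to one of the two players. If $S$ is the set of items given to the first player and $\overline S$ the set of items given to the second one, the envy is $$\mathsf{envy}=\max\Big\{\sum_{j\in\overline S}v^1_j-\sum_{j\in S}v^1_j,\ \sum_{j\in S}v^2_j-\sum_{j\in\overline S}v^2_j\Big\}.$$ There is a single (randomized) online algorithm, independent of $n$, $D_1$ and $D_2$, with the following two properties. 1. It is efficient: there is a polynomial $p$ such that for all $n$, $D_1$, $D_2$, all sequences of item values and all outcomes of its random choices, it allocates the $n$ items in at most $p(n)$ steps in total. Here the algorithm is a program for a unit-cost real RAM (natural number and real memory with indirect addressing; addition, truncated subtraction and comparison of natural numbers; conversion of natural numbers to reals; $+,-,\times,/$ and comparison of reals; no rounding) that can also draw independent uniformly random reals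 from $[0,1]$ and query the values $D_i((-\infty,x])$ and $D_i((-\infty,x))$. 2. Its envy is $O(n^{c/\log\log n})$ with high probability: for every $k\in\mathbb N$ there are constants $c, C$, depending only on $k$, such that for all $n\ge 3$ and all $D_1, D_2$, $$\Pr\big[\mathsf{envy}> C\,n^{c/\log\log n}\big]\le n^{-k},$$ where the probability is over the item values and the random choices of the algorithm. -/

import Mathlib

/-!
# Randomized real-RAM programs and the online envy minimization problem

Computation is modelled by structured programs for a unit-cost real RAM: a memory of natural
numbers and a memory of real numbers, both with indirect addressing, exact field operations and
comparisons on reals, addition, truncated subtraction and comparisons on naturals, an instruction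
that draws a uniformly distributed real from `[0,1]`, and queries to the distributions that are
part of the problem instance. There is no rounding or floor operation.
-/

open MeasureTheory

namespace RealRAM

/-- Contents of the two memories, together with the number of random reals drawn so far. -/
structure State where
  nats : ℕ → ℕ
  reals : ℕ → ℝ
  draws : ℕ

/-- Expressions with natural number values; `cell e` reads the natural number at address `e`. -/
inductive NatExpr where
  | lit (k : ℕ)
  | cell (e : NatExpr)
  | add (e₁ e₂ : NatExpr)
  | sub (e₁ e₂ : NatExpr)

/-- Expressions with real values; `cell e` reads the real number at address `e`, and
`massLe i e`, `massLt i e` query the `i`-th distribution. -/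
inductive RealExpr where
  | ofNat (e : NatExpr)
  | cell (e : NatExpr)
  | add (e₁ e₂ : RealExpr)
  | sub (e₁ e₂ : RealExpr)
  | mul (e₁ e₂ : RealExpr)
  | div (e₁ e₂ : RealExpr)
  | massLe (i : Fin 2) (e : RealExpr)
  | massLt (i : Fin 2) (e : RealExpr)

/-- Tests. -/
inductive Test where
  | natLe (e₁ e₂ : NatExpr)
  | realLe (e₁ e₂ : RealExpr)
  | not (b : Test)
  | and (b₁ b₂ : Test)

/-- Programs. `setNat a e` and `setReal a e` store the value of `e` at address `a`, `draw a` stores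
a fresh random real at address `a`, and `loop b c` repeats `c` as long as `b` holds. -/
inductive Program where
  | skip
  | setNat (a e : NatExpr)
  | setReal (a : NatExpr) (e : RealExpr)
  | draw (a : NatExpr)
  | seq (c₁ c₂ : Program)
  | ite (b : Test) (c₁ c₂ : Program)
  | loop (b : Test) (c : Program)

def NatExpr.eval (s : State) : NatExpr → ℕ
  | lit k => k
  | cell e => s.nats (e.eval s)
  | add e₁ e₂ => e₁.eval s + e₂.eval s
  | sub e₁ e₂ => e₁.eval s - e₂.eval s

/-- A query `massLe i e` returns the mass of `(-∞, x]`, and `massLt i e` the mass of `(-∞, x)`,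
under the `i`-th distribution, where `x` is the value of `e`. -/
noncomputable def RealExpr.eval (D : Fin 2 → Measure ℝ) (s : State) : RealExpr → ℝ
  | ofNat e => (e.eval s : ℝ)
  | cell e => s.reals (e.eval s)
  | add e₁ e₂ => e₁.eval D s + e₂.eval D s
  | sub e₁ e₂ => e₁.eval D s - e₂.eval D s
  | mul e₁ e₂ => e₁.eval D s * e₂.eval D s
  | div e₁ e₂ => e₁.eval D s / e₂.eval D s
  | massLe i e => (D i).real (Set.Iic (e.eval D s))
  | massLt i e => (D i).real (Set.Iio (e.eval D s))

def Test.Holds (D : Fin 2 → Measure ℝ) (s : State) : Test → Prop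
  | natLe e₁ e₂ => e₁.eval s ≤ e₂.eval s
  | realLe e₁ e₂ => e₁.eval D s ≤ e₂.eval D s
  | not b => ¬ b.Holds D s
  | and b₁ b₂ => b₁.Holds D s ∧ b₂.Holds D s

/-- `Exec D ω c s t s'`: started in the state `s`, the program `c` halts after `t` steps in the
state `s'`, where `D` answers the queries and `ω` is the sequence of random reals. Every basic
command and every test counts as one step; since a program contains finitely many expressions,
charging for each operation inside them would change `t` at most by a factor that depends
on the program only. -/
inductive Exec (D : Fin 2 → Measure ℝ) (ω : ℕ → unitInterval) :
    Program → State → ℕ → State → Prop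
  | skip (s : State) : Exec D ω .skip s 1 s
  | setNat (a e : NatExpr) (s : State) :
      Exec D ω (.setNat a e) s 1
        { s with nats := Function.update s.nats (a.eval s) (e.eval s) }
  | setReal (a : NatExpr) (e : RealExpr) (s : State) :
      Exec D ω (.setReal a e) s 1
        { s with reals := Function.update s.reals (a.eval s) (e.eval D s) }
  | draw (a : NatExpr) (s : State) :
      Exec D ω (.draw a) s 1
        { s with
          reals := Function.update s.reals (a.eval s) (ω s.draws : ℝ)
          draws := s.draws + 1 }
  | seq {c₁ c₂ : Program} {s s' s'' : State} {t₁ t₂ : ℕ}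
      (h₁ : Exec D ω c₁ s t₁ s') (h₂ : Exec D ω c₂ s' t₂ s'') :
      Exec D ω (.seq c₁ c₂) s (t₁ + t₂) s''
  | ite_true {b : Test} {c₁ c₂ : Program} {s s' : State} {t : ℕ}
      (hb : b.Holds D s) (h : Exec D ω c₁ s t s') :
      Exec D ω (.ite b c₁ c₂) s (t + 1) s'
  | ite_false {b : Test} {c₁ c₂ : Program} {s s' : State} {t : ℕ}
      (hb : ¬ b.Holds D s) (h : Exec D ω c₂ s t s') :
      Exec D ω (.ite b c₁ c₂) s (t + 1) s'
  | loop_done {b : Test} {c : Program} {s : State} (hb : ¬ b.Holds D s) :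
      Exec D ω (.loop b c) s 1 s
  | loop_next {b : Test} {c : Program} {s s' s'' : State} {t₁ t₂ : ℕ}
      (hb : b.Holds D s) (h₁ : Exec D ω c s t₁ s') (h₂ : Exec D ω (.loop b c) s' t₂ s'') :
      Exec D ω (.loop b c) s (t₁ + t₂ + 1) s''

end RealRAM

namespace OnlineEnvy

open RealRAM

/-- An online allocation algorithm: one program that is run before the first item arrives, and one
that is run on the arrival of every item. The memory is kept between these runs. -/
structure Algorithm where
  setup : Program
  round : Program

/-- At the beginning all memory cells are zero, except that the number `n` of items is stored in
cell `0` of the natural number memory. -/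
def startState (n : ℕ) : State where
  nats := fun a => if a = 0 then n else 0
  reals := fun _ => 0
  draws := 0

/-- The arrival of an item: its values for the first and for the second player are written
to the cells `0` and `1` of the real memory. -/
noncomputable def present (s : State) (x : Fin 2 → ℝ) : State :=
  { s with reals := Function.update (Function.update s.reals 0 (x 0)) 1 (x 1) }

/-- `A.Reaches D ω v j s S t`: after `j` of the `n` items, where item `i` has the value `v i p` for
player `p`, the algorithm is in the state `s`, has used `t` steps in total, and has given the items
of `S` to the first player and the other ones of the first `j` items to the second player. The
item that has just arrived goes to the first player if and only if the round leaves a nonzero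
number in cell `1` of the natural number memory. -/
inductive Algorithm.Reaches (A : Algorithm) (D : Fin 2 → Measure ℝ) (ω : ℕ → unitInterval)
    {n : ℕ} (v : Fin n → Fin 2 → ℝ) : ℕ → State → Finset (Fin n) → ℕ → Prop
  | start {s : State} {t : ℕ} (h : Exec D ω A.setup (startState n) t s) :
      Algorithm.Reaches A D ω v 0 s ∅ t
  | next (j : Fin n) {s s' : State} {S : Finset (Fin n)} {t t' : ℕ}
      (h : Algorithm.Reaches A D ω v j s S t)
      (h' : Exec D ω A.round (present s (v j)) t' s') :
      Algorithm.Reaches A D ω v (j + 1) s' (if s'.nats 1 ≠ 0 then insert j S else S) (t + t')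

/-- `A.Allocates D ω v S t`: on the items with values `v`, with distributions `D` and random
reals `ω`, the algorithm allocates exactly the items of `S` to the first player, using `t` steps
in total. -/
def Algorithm.Allocates (A : Algorithm) (D : Fin 2 → Measure ℝ) (ω : ℕ → unitInterval)
    {n : ℕ} (v : Fin n → Fin 2 → ℝ) (S : Finset (Fin n)) (t : ℕ) : Prop :=
  ∃ s, A.Reaches D ω v n s S t

/-- The envy when the first player (index `0`) gets `S` and the second one (index `1`) gets the
complement of `S`. -/
noncomputable def envy {n : ℕ} (v : Fin n → Fin 2 → ℝ) (S : Finset (Fin n)) : ℝ :=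
  max ((∑ j ∈ Sᶜ, v j 0) - ∑ j ∈ S, v j 0) ((∑ j ∈ S, v j 1) - ∑ j ∈ Sᶜ, v j 1)

/-- The joint law of the item values and of the random reals of the algorithm: all values are
independent, those for player `p` have the law `D p`, and the random reals are independent of them,
mutually independent and uniform on `[0,1]`. -/
noncomputable def law (D : Fin 2 → Measure ℝ) (n : ℕ) :
    Measure ((Fin n → Fin 2 → ℝ) × (ℕ → unitInterval)) :=
  (Measure.pi fun _ : Fin n => Measure.pi D).prod
    (Measure.infinitePi fun _ : ℕ => (volume : Measure unitInterval))

end OnlineEnvy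

/-! ### Resampling one coordinate of a product measure -/

-- Each item is a point `x` of the plane, and giving it to the first or second player adds or
-- subtracts `x` from a walk `w`. The envy is at most the larger absolute coordinate of the final
-- position. The algorithm runs the self-balancing walk: it adds `x` with probability `(1 - ⟨w, x⟩ /
-- c) / 2`, a drift towards the origin. It never queries the distributions, and the tail bound holds
-- for every fixed sequence of values in `[0,1]`.
--
-- While `|⟨w, x⟩| ≤ c` this probability is genuine, and Hoeffding's lemma bounds the expectation of
-- `exp ⟨w, θ⟩` after one step by its value before the step at a shortened `θ`, times a factor that
-- the shortening pays for (`contraction`). So `w` stays subgaussian with variance `c`,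
-- independently of `n` (`lintegral_exp_walk_le`). Markov's inequality and a union bound over the
-- first violation give failure probability at most `(2n + 4) exp(-c / 4)`.
--
-- Taking `c` of order `log² n` makes this smaller than every power of `1 / n` once `n` is large, so
-- a single algorithm serves all `k`; for the remaining `n` the trivial bound `n` on the envy is
-- absorbed into `C`. Finally `log² n ≤ n ^ (8 / log log n)`.

theorem measurePreserving_update_infinitePi {ι : Type*} [DecidableEq ι] {X : Type*}
    [MeasurableSpace X] (μ : Measure X) [IsProbabilityMeasure μ] (j : ι) :
    MeasurePreserving (fun p : (ι → X) × X => Function.update p.1 j p.2)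
      ((Measure.infinitePi fun _ : ι => μ).prod μ) (Measure.infinitePi fun _ : ι => μ) := by
  have hm : Measurable (fun p : (ι → X) × X => Function.update p.1 j p.2) := by
    refine measurable_pi_lambda _ fun i => ?_
    by_cases h : i = j
    · subst h; simpa using measurable_snd
    · simp only [Function.update_of_ne h]
      exact (measurable_pi_apply i).comp measurable_fst
  refine ⟨hm, Measure.eq_infinitePi _ fun s t ht => ?_⟩
  rw [Measure.map_apply hm (.pi s.countable_toSet fun i _ => ht i)]
  -- On boxes the old coordinate `j` is forgotten and the fresh sample takes over its constraint, if
  -- there is one.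
  have hpre : (fun p : (ι → X) × X => Function.update p.1 j p.2) ⁻¹' (Set.pi s t) =
      (Set.pi (s.erase j : Finset ι) t) ×ˢ (if j ∈ s then t j else Set.univ) := by
    ext ⟨ω, u⟩
    simp only [Set.mem_preimage, Set.mem_pi, Set.mem_prod, Finset.mem_coe, Finset.mem_erase]
    constructor
    · intro h
      refine ⟨fun i hi => by simpa [Function.update_of_ne hi.1] using h i hi.2, ?_⟩
      split_ifs with hj
      · simpa using h j hj
      · trivial
    · rintro ⟨h₁, h₂⟩ i hi
      by_cases hij : i = j
      · subst hij; simpa [hi] using h₂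
      · simpa [Function.update_of_ne hij] using h₁ i ⟨hij, hi⟩
  rw [hpre, Measure.prod_prod, Measure.infinitePi_pi _ fun i _ => ht i]
  split_ifs with hj
  · exact Finset.prod_erase_mul s (fun i => μ (t i)) hj
  · simp [Finset.erase_eq_of_notMem hj]

/-- Stands in for conditioning on all draws except the one with index `j`. -/
theorem lintegral_infinitePi_update {ι : Type*} [DecidableEq ι] {X : Type*}
    [MeasurableSpace X] (μ : Measure X) [IsProbabilityMeasure μ] (j : ι)
    {f : (ι → X) → ENNReal} (hf : Measurable f) :
    ∫⁻ ω, f ω ∂(Measure.infinitePi fun _ : ι => μ) =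
      ∫⁻ ω, ∫⁻ u, f (Function.update ω j u) ∂μ ∂(Measure.infinitePi fun _ : ι => μ) := by
  have h := measurePreserving_update_infinitePi μ j
  rw [← h.lintegral_comp hf]
  exact lintegral_prod _ (hf.comp h.measurable).aemeasurable

/-! ### A biased random sign -/

theorem measurableSet_le_threshold (p : ℝ) : MeasurableSet {u : unitInterval | (u : ℝ) ≤ p} :=
  measurableSet_le measurable_subtype_coe measurable_const

theorem volume_real_le_threshold {p : ℝ} (h₀ : 0 ≤ p) (h₁ : p ≤ 1) :
    (volume : Measure unitInterval).real {u | (u : ℝ) ≤ p} = p := by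
  have : {u : unitInterval | (u : ℝ) ≤ p} = Set.Iic ⟨p, h₀, h₁⟩ := rfl
  rw [this, measureReal_def, unitInterval.volume_Iic, ENNReal.toReal_ofReal h₀]

/-- Hoeffding's lemma for a random sign with mean `m`. -/
theorem lintegral_exp_sign_le {m : ℝ} (hm : |m| ≤ 1) (s : ℝ) :
    ∫⁻ u : unitInterval, ENNReal.ofReal
        (Real.exp (s * if (u : ℝ) ≤ (1 + m) / 2 then 1 else -1)) ≤
      ENNReal.ofReal (Real.exp (s * m + s ^ 2 / 2)) := by
  obtain ⟨hm₁, hm₂⟩ := abs_le.mp hm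
  set X : unitInterval → ℝ := fun u => if (u : ℝ) ≤ (1 + m) / 2 then 1 else -1 with hX
  have hXm : Measurable X :=
    Measurable.ite (measurableSet_le_threshold _) measurable_const measurable_const
  have hXb : ∀ u, X u ∈ Set.Icc (-1 : ℝ) 1 := by
    intro u
    simp only [hX]
    split_ifs <;> norm_num
  have hmean : ∫ u, X u = m := by
    have : X = fun u => 2 * Set.indicator {u : unitInterval | (u : ℝ) ≤ (1 + m) / 2}
        (fun _ => (1 : ℝ)) u - 1 := by
      funext u
      simp only [hX, Set.indicator_apply, Set.mem_ofPred_eq]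
      split_ifs <;> norm_num
    rw [this, integral_sub, integral_const_mul, integral_indicator_const _
      (measurableSet_le_threshold _), volume_real_le_threshold (by linarith) (by linarith)]
    · simp; ring
    · exact ((integrable_const _).indicator (measurableSet_le_threshold _)).const_mul _
    · exact integrable_const _
  have h := ProbabilityTheory.hasSubgaussianMGF_of_mem_Icc (μ := (volume : Measure unitInterval))
    hXm.aemeasurable (Filter.Eventually.of_forall hXb)
  have hmgf := h.mgf_le s
  have hint := h.integrable_exp_mul s
  rw [hmean] at hmgf hint
  -- Hoeffding's variance proxy for values in `[-1, 1]`.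
  have hone : ((((‖(1 : ℝ) - -1‖₊ / 2) ^ 2 : NNReal)) : ℝ) = 1 := by
    push_cast
    norm_num
  rw [hone, one_mul, ProbabilityTheory.mgf] at hmgf
  have hsplit : ∀ u, Real.exp (s * X u) = Real.exp (s * m) * Real.exp (s * (X u - m)) := by
    intro u
    rw [← Real.exp_add]
    ring_nf
  change ∫⁻ u, ENNReal.ofReal (Real.exp (s * X u)) ≤ _
  simp_rw [hsplit]
  rw [← ofReal_integral_eq_lintegral_ofReal (hint.const_mul _)
    (Filter.Eventually.of_forall fun u => by positivity), integral_const_mul, Real.exp_add]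
  exact ENNReal.ofReal_le_ofReal (by gcongr)

/-! ### The self-balancing walk in the plane -/

namespace SelfBalancing

/-- The inner product of the plane. -/
def dot (a b : ℝ × ℝ) : ℝ := a.1 * b.1 + a.2 * b.2

/-- The walk at `w` adds `x` if `2 c u ≤ c - ⟨w, x⟩` and subtracts `x` otherwise. -/
noncomputable def step (c : ℝ) (w x : ℝ × ℝ) (u : ℝ) : ℝ × ℝ :=
  if 2 * c * u ≤ c - dot w x then w + x else w - x

/-- The self-balancing walk with increments `± x j`, driven by `ω`. -/
noncomputable def walk (c : ℝ) (x : ℕ → ℝ × ℝ) (ω : ℕ → unitInterval) : ℕ → ℝ × ℝ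
  | 0 => 0
  | j + 1 => step c (walk c x ω j) (x j) (ω j)

/-- Before time `j`, the walk has not been too far in the direction of an increment. -/
def Tame (c : ℝ) (x : ℕ → ℝ × ℝ) (ω : ℕ → unitInterval) (j : ℕ) : Prop :=
  ∀ i < j, |dot (walk c x ω i) (x i)| ≤ c

theorem walk_congr {c : ℝ} {x : ℕ → ℝ × ℝ} {ω ω' : ℕ → unitInterval} {j : ℕ}
    (h : ∀ i < j, ω i = ω' i) : walk c x ω j = walk c x ω' j := by
  induction j with
  | zero => rfl
  | succ j ih => rw [walk, walk, ih fun i hi => h i (by omega), h j (by omega)]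

theorem walk_update {c : ℝ} {x : ℕ → ℝ × ℝ} {ω : ℕ → unitInterval} {i j : ℕ} (h : i ≤ j)
    (u : unitInterval) : walk c x (Function.update ω j u) i = walk c x ω i :=
  walk_congr fun _ hi => Function.update_of_ne (by omega) _ _

/-- Tameness before `j + 1` concerns positions up to time `j`, hence only draws with index below
`j`. -/
theorem tame_update {c : ℝ} {x : ℕ → ℝ × ℝ} {ω : ℕ → unitInterval} {j : ℕ} (u : unitInterval) :
    Tame c x (Function.update ω j u) (j + 1) ↔ Tame c x ω (j + 1) := by
  unfold Tame
  refine forall₂_congr fun i hi => ?_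
  rw [walk_update (by omega)]

/-- Increments may vary with the sample point, so that this serves both fixed and random item
values. -/
theorem measurable_walk {Ω : Type*} [MeasurableSpace Ω] (c : ℝ) {x : Ω → ℕ → ℝ × ℝ}
    {ω : Ω → ℕ → unitInterval} (hx : ∀ i, Measurable fun a => x a i)
    (hω : ∀ i, Measurable fun a => ω a i) (j : ℕ) : Measurable fun a => walk c (x a) (ω a) j := by
  induction j with
  | zero => exact measurable_const
  | succ j ih =>
    have hu : Measurable fun a => (ω a j : ℝ) := measurable_subtype_coe.comp (hω j)
    have hd : Measurable fun a => dot (walk c (x a) (ω a) j) (x a j) := by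
      unfold dot
      exact (ih.fst.mul (hx j).fst).add (ih.snd.mul (hx j).snd)
    exact Measurable.ite (measurableSet_le (hu.const_mul (2 * c)) (hd.const_sub c))
      (ih.add (hx j)) (ih.sub (hx j))

theorem measurable_dot_walk (c : ℝ) (x : ℕ → ℝ × ℝ) (θ : ℝ × ℝ) (j : ℕ) :
    Measurable fun ω => dot (walk c x ω j) θ := by
  have h : Measurable fun ω => walk c x ω j :=
    measurable_walk (x := fun _ => x) c (fun _ => measurable_const) (fun i => measurable_pi_apply i) j
  unfold dot
  exact (h.fst.mul_const _).add (h.snd.mul_const _)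

theorem measurableSet_tame (c : ℝ) (x : ℕ → ℝ × ℝ) (j : ℕ) :
    MeasurableSet {ω | Tame c x ω j} := by
  have : {ω | Tame c x ω j} = ⋂ i, ⋂ _ : i < j, {ω | |dot (walk c x ω i) (x i)| ≤ c} := by
    ext; simp [Tame]
  rw [this]
  exact .iInter fun i => .iInter fun _ =>
    measurableSet_le (continuous_abs.measurable.comp (measurable_dot_walk c x (x i) i))
      measurable_const

/-- Puts the step in the form of a random sign with mean `-⟨w, x⟩ / c`, ready for Hoeffding's lemma.
-/
theorem dot_step (c : ℝ) (hc : 0 < c) (w x θ : ℝ × ℝ) (u : ℝ) :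
    dot (step c w x u) θ =
      dot w θ + dot x θ * if u ≤ (1 + -(dot w x / c)) / 2 then 1 else -1 := by
  have : 2 * c * u ≤ c - dot w x ↔ u ≤ (1 + -(dot w x / c)) / 2 := by
    rw [show (1 + -(dot w x / c)) / 2 = (c - dot w x) / (2 * c) by field_simp; ring,
      le_div_iff₀ (by positivity), mul_comm u]
  simp only [step, this]
  split_ifs <;> simp [dot] <;> ring

/-- One step of the walk does not spoil a Gaussian bound with variance `c`. -/
theorem lintegral_exp_step_le {c : ℝ} (hc : 2 ≤ c) {w x : ℝ × ℝ} (hw : |dot w x| ≤ c)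
    (θ : ℝ × ℝ) :
    ∫⁻ u : unitInterval, ENNReal.ofReal (Real.exp (dot (step c w x u) θ)) ≤
      ENNReal.ofReal (Real.exp (dot w (θ - (dot x θ / c) • x))) *
        ENNReal.ofReal (Real.exp (dot x θ ^ 2 / 2)) := by
  have hc₀ : 0 < c := by linarith
  simp_rw [dot_step c hc₀, Real.exp_add, ENNReal.ofReal_mul (Real.exp_pos _).le]
  rw [lintegral_const_mul' _ _ ENNReal.ofReal_ne_top]
  have hm : |-(dot w x / c)| ≤ 1 := by
    rw [abs_neg, abs_div, abs_of_pos hc₀]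
    exact (div_le_one hc₀).mpr hw
  refine (mul_le_mul_right (lintegral_exp_sign_le hm _) _).trans (le_of_eq ?_)
  rw [← ENNReal.ofReal_mul (Real.exp_pos _).le, ← ENNReal.ofReal_mul (Real.exp_pos _).le,
    ← Real.exp_add, ← Real.exp_add]
  congr 2
  simp only [dot, Prod.fst_sub, Prod.snd_sub, Prod.smul_fst, Prod.smul_snd, smul_eq_mul]
  ring

/-- With `a = ⟨x, θ⟩`, the drift lowers `c |θ|²` by `2a² - a² |x|² / c`, which is at least `a²`
since `|x|² ≤ 2 ≤ c`. This pays exactly for the fluctuation of the sign. -/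
theorem contraction {c : ℝ} (hc : 2 ≤ c) {x : ℝ × ℝ} (hx : dot x x ≤ 2) (θ : ℝ × ℝ) :
    c * dot (θ - (dot x θ / c) • x) (θ - (dot x θ / c) • x) / 2 + dot x θ ^ 2 / 2 ≤
      c * dot θ θ / 2 := by
  have hc₀ : 0 < c := by linarith
  have hexp : c * dot (θ - (dot x θ / c) • x) (θ - (dot x θ / c) • x) =
      c * dot θ θ - 2 * dot x θ ^ 2 + dot x θ ^ 2 * (dot x x / c) := by
    obtain ⟨a, ha⟩ : ∃ a, a = dot x θ := ⟨_, rfl⟩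
    have ha' : a = x.1 * θ.1 + x.2 * θ.2 := ha
    rw [← ha]
    simp only [dot, Prod.fst_sub, Prod.snd_sub, Prod.smul_fst, Prod.smul_snd, smul_eq_mul]
    field_simp
    rw [ha']
    ring
  have hle : dot x x / c ≤ 1 := (div_le_one hc₀).mpr (hx.trans hc)
  nlinarith [mul_le_mul_of_nonneg_left hle (sq_nonneg (dot x θ))]

/-- The law of the random reals that drive the walk. -/
noncomputable abbrev driver : Measure (ℕ → unitInterval) :=
  Measure.infinitePi fun _ : ℕ => (volume : Measure unitInterval)

/-- On the event that it stays tame, the walk is subgaussian with variance `c`. -/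
theorem lintegral_exp_walk_le {c : ℝ} (hc : 2 ≤ c) {x : ℕ → ℝ × ℝ} (hx : ∀ j, dot (x j) (x j) ≤ 2)
    (j : ℕ) (θ : ℝ × ℝ) :
    ∫⁻ ω, {ω | Tame c x ω j}.indicator
        (fun ω => ENNReal.ofReal (Real.exp (dot (walk c x ω j) θ))) ω ∂driver ≤
      ENNReal.ofReal (Real.exp (c * dot θ θ / 2)) := by
  -- The induction hypothesis is needed at the shortened vector `θ'`.
  induction j generalizing θ with
  | zero =>
    have : {ω | Tame c x ω 0} = Set.univ := by ext; simp [Tame]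
    have hθ : 0 ≤ dot θ θ := add_nonneg (mul_self_nonneg _) (mul_self_nonneg _)
    have hpos : 0 ≤ c * dot θ θ / 2 := by positivity
    simpa [this, walk, dot] using Real.one_le_exp hpos
  | succ j ih =>
    have hmeas : ∀ j θ, Measurable ({ω | Tame c x ω j}.indicator
        fun ω => ENNReal.ofReal (Real.exp (dot (walk c x ω j) θ))) := fun j θ =>
      (ENNReal.measurable_ofReal.comp (Real.measurable_exp.comp
        (measurable_dot_walk c x θ j))).indicator (measurableSet_tame c x j)
    rw [lintegral_infinitePi_update _ j (hmeas _ _)]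
    set θ' := θ - (dot (x j) θ / c) • x j
    calc _ ≤ ∫⁻ ω, {ω | Tame c x ω j}.indicator
            (fun ω => ENNReal.ofReal (Real.exp (dot (walk c x ω j) θ'))) ω *
              ENNReal.ofReal (Real.exp (dot (x j) θ ^ 2 / 2)) ∂driver := by
          refine lintegral_mono fun ω => ?_
          by_cases hs : Tame c x ω (j + 1)
          · have hs' : Tame c x ω j := fun i hi => hs i (by omega)
            have hmem : ∀ u, Function.update ω j u ∈ {ω | Tame c x ω (j + 1)} := fun u =>
              (tame_update u).mpr hs
            have hmem' : ω ∈ {ω | Tame c x ω j} := hs'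
            simp_rw [Set.indicator_of_mem (hmem _), Set.indicator_of_mem hmem', walk,
              walk_update le_rfl, Function.update_self]
            exact lintegral_exp_step_le hc (hs j (by omega)) θ
          · simp [tame_update, hs]
      _ ≤ ENNReal.ofReal (Real.exp (c * dot θ' θ' / 2)) *
            ENNReal.ofReal (Real.exp (dot (x j) θ ^ 2 / 2)) := by
          rw [lintegral_mul_const _ (hmeas _ _)]
          exact mul_le_mul_left (ih θ') _
      _ ≤ _ := by
          rw [← ENNReal.ofReal_mul (Real.exp_pos _).le, ← Real.exp_add]
          exact ENNReal.ofReal_le_ofReal (Real.exp_le_exp.mpr (contraction hc (hx j) θ))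

-- Tail bounds for the walk

theorem measure_tame_lt_dot_le {c : ℝ} (hc : 2 ≤ c) {x : ℕ → ℝ × ℝ}
    (hx : ∀ j, dot (x j) (x j) ≤ 2) (j : ℕ) {θ : ℝ × ℝ} (hθ : dot θ θ ≤ 2) :
    driver {ω | Tame c x ω j ∧ c < dot (walk c x ω j) θ} ≤
      ENNReal.ofReal (Real.exp (-c / 4)) := by
  -- The factor `1 / 2` minimizes the Chernoff exponent `-λ c + λ² c` when `|θ|² = 2`.
  set φ : ℝ × ℝ := (1 / 2 : ℝ) • θ with hφ
  have hdot : ∀ w, dot w φ = dot w θ / 2 := fun w => by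
    simp only [hφ, dot, Prod.smul_fst, Prod.smul_snd, smul_eq_mul]; ring
  have hφφ : dot φ φ ≤ 1 / 2 := by
    have : dot φ φ = dot θ θ / 4 := by
      simp only [hφ, dot, Prod.smul_fst, Prod.smul_snd, smul_eq_mul]; ring
    linarith
  have hcancel : ENNReal.ofReal (Real.exp (-(c / 2))) * ENNReal.ofReal (Real.exp (c / 2)) = 1 := by
    rw [← ENNReal.ofReal_mul (Real.exp_pos _).le, ← Real.exp_add]; simp
  have hset : MeasurableSet {ω | Tame c x ω j ∧ c < dot (walk c x ω j) θ} :=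
    (measurableSet_tame c x j).inter
      (measurableSet_lt measurable_const (measurable_dot_walk c x θ j))
  calc driver {ω | Tame c x ω j ∧ c < dot (walk c x ω j) θ}
      = ∫⁻ ω, {ω | Tame c x ω j ∧ c < dot (walk c x ω j) θ}.indicator 1 ω ∂driver :=
        (lintegral_indicator_one hset).symm
    _ ≤ ∫⁻ ω, ENNReal.ofReal (Real.exp (-(c / 2))) * {ω | Tame c x ω j}.indicator
          (fun ω => ENNReal.ofReal (Real.exp (dot (walk c x ω j) φ))) ω ∂driver := by
        refine lintegral_mono fun ω => ?_
        by_cases hω : ω ∈ {ω | Tame c x ω j ∧ c < dot (walk c x ω j) θ}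
        swap
        · simp only [Set.indicator_of_notMem hω, zero_le]
        rw [Set.indicator_of_mem hω]
        rw [Set.indicator_of_mem (show ω ∈ {ω | Tame c x ω j} from hω.1), Pi.one_apply, ← hcancel]
        refine mul_le_mul_right (ENNReal.ofReal_le_ofReal (Real.exp_le_exp.mpr ?_)) _
        rw [hdot]
        linarith [hω.2]
    _ ≤ ENNReal.ofReal (Real.exp (-(c / 2))) * ENNReal.ofReal (Real.exp (c * dot φ φ / 2)) := by
        rw [lintegral_const_mul' _ _ ENNReal.ofReal_ne_top]
        exact mul_le_mul_right (lintegral_exp_walk_le hc hx j φ) _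
    _ ≤ _ := by
        rw [← ENNReal.ofReal_mul (Real.exp_pos _).le, ← Real.exp_add]
        refine ENNReal.ofReal_le_ofReal (Real.exp_le_exp.mpr ?_)
        nlinarith

theorem measure_tame_lt_abs_dot_le {c : ℝ} (hc : 2 ≤ c) {x : ℕ → ℝ × ℝ}
    (hx : ∀ j, dot (x j) (x j) ≤ 2) (j : ℕ) {θ : ℝ × ℝ} (hθ : dot θ θ ≤ 2) :
    driver {ω | Tame c x ω j ∧ c < |dot (walk c x ω j) θ|} ≤
      2 * ENNReal.ofReal (Real.exp (-c / 4)) := by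
  have hneg : ∀ w, dot w (-θ) = -dot w θ := fun w => by simp [dot]; ring
  have hθ' : dot (-θ) (-θ) ≤ 2 := by simpa [dot] using hθ
  rw [two_mul]
  refine (measure_mono fun ω hω => ?_).trans ((measure_union_le _ _).trans
    (add_le_add (measure_tame_lt_dot_le hc hx j hθ) (measure_tame_lt_dot_le hc hx j hθ')))
  obtain ⟨h₁, h₂⟩ := hω
  rcases lt_abs.mp h₂ with h | h
  · exact Or.inl ⟨h₁, h⟩
  · exact Or.inr ⟨h₁, by rw [hneg]; exact h⟩

theorem measure_walk_large_le {c : ℝ} (hc : 2 ≤ c) {x : ℕ → ℝ × ℝ}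
    (hx : ∀ j, dot (x j) (x j) ≤ 2) (n : ℕ) :
    driver {ω | c < max |(walk c x ω n).1| |(walk c x ω n).2|} ≤
      (2 * n + 4) * ENNReal.ofReal (Real.exp (-c / 4)) := by
  -- Either the walk is tame up to `n` and a coordinate is large, or there is a first violation `j <
  -- n`, before which it is tame.
  have hcover : {ω | c < max |(walk c x ω n).1| |(walk c x ω n).2|} ⊆
      (⋃ j ∈ Finset.range n, {ω | Tame c x ω j ∧ c < |dot (walk c x ω j) (x j)|}) ∪
        ({ω | Tame c x ω n ∧ c < |dot (walk c x ω n) (1, 0)|} ∪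
          {ω | Tame c x ω n ∧ c < |dot (walk c x ω n) (0, 1)|}) := by
    intro ω hω
    by_cases hs : Tame c x ω n
    · right
      have hlt : c < max |(walk c x ω n).1| |(walk c x ω n).2| := hω
      rcases lt_max_iff.mp hlt with h | h
      · exact Or.inl ⟨hs, by simpa [dot] using h⟩
      · exact Or.inr ⟨hs, by simpa [dot] using h⟩
    · left
      classical
      have hex : ∃ i, i < n ∧ c < |dot (walk c x ω i) (x i)| := by
        simpa [Tame] using hs
      refine Set.mem_biUnion (Finset.mem_coe.mpr (Finset.mem_range.mpr (Nat.find_spec hex).1))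
        ⟨fun i hi => ?_, (Nat.find_spec hex).2⟩
      by_contra h
      exact Nat.find_min hex hi ⟨hi.trans (Nat.find_spec hex).1, not_le.mp h⟩
  have h₁ : dot (1, 0) (1, 0) ≤ 2 := by norm_num [dot]
  have h₂ : dot (0, 1) (0, 1) ≤ 2 := by norm_num [dot]
  refine (measure_mono hcover).trans <| (measure_union_le _ _).trans <|
    (add_le_add ((measure_biUnion_finset_le _ _).trans
      (Finset.sum_le_sum fun j _ => measure_tame_lt_abs_dot_le hc hx j (hx j)))
      ((measure_union_le _ _).trans (add_le_add (measure_tame_lt_abs_dot_le hc hx n h₁)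
        (measure_tame_lt_abs_dot_le hc hx n h₂)))).trans (le_of_eq ?_)
  rw [Finset.sum_const, Finset.card_range, nsmul_eq_mul]
  ring

end SelfBalancing

/-! ### Programs are deterministic -/

namespace RealRAM

/-- Makes the explicitly constructed runs the only ones. -/
theorem Exec.deterministic {D : Fin 2 → Measure ℝ} {ω : ℕ → unitInterval} {c : Program}
    {s s₁ s₂ : State} {t₁ t₂ : ℕ} (h₁ : Exec D ω c s t₁ s₁) (h₂ : Exec D ω c s t₂ s₂) :
    t₁ = t₂ ∧ s₁ = s₂ := by
  induction h₁ generalizing t₂ s₂ with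
  | skip | setNat | setReal | draw => cases h₂; exact ⟨rfl, rfl⟩
  | seq _ _ ih₁ ih₂ =>
    cases h₂ with
    | seq k₁ k₂ =>
      obtain ⟨rfl, rfl⟩ := ih₁ k₁
      obtain ⟨rfl, rfl⟩ := ih₂ k₂
      exact ⟨rfl, rfl⟩
  | ite_true hb _ ih =>
    cases h₂ with
    | ite_true _ k =>
      obtain ⟨rfl, rfl⟩ := ih k
      exact ⟨rfl, rfl⟩
    | ite_false hb' _ => exact absurd hb hb'
  | ite_false hb _ ih =>
    cases h₂ with
    | ite_true hb' _ => exact absurd hb' hb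
    | ite_false _ k =>
      obtain ⟨rfl, rfl⟩ := ih k
      exact ⟨rfl, rfl⟩
  | loop_done hb =>
    cases h₂ with
    | loop_done _ => exact ⟨rfl, rfl⟩
    | loop_next hb' _ _ => exact absurd hb' hb
  | loop_next hb _ _ ih₁ ih₂ =>
    cases h₂ with
    | loop_done hb' => exact absurd hb hb'
    | loop_next _ k₁ k₂ =>
      obtain ⟨rfl, rfl⟩ := ih₁ k₁
      obtain ⟨rfl, rfl⟩ := ih₂ k₂
      exact ⟨rfl, rfl⟩

/-- The natural number in the cell with the fixed address `k`. -/
abbrev NatExpr.reg (k : ℕ) : NatExpr := .cell (.lit k)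

/-- The real number in the cell with the fixed address `k`. -/
abbrev RealExpr.reg (k : ℕ) : RealExpr := .cell (.lit k)

/-- A natural number as a real constant. -/
abbrev RealExpr.const (k : ℕ) : RealExpr := .ofNat (.lit k)

end RealRAM

/-! ### The self-balancing allocation algorithm -/

namespace OnlineEnvy

open RealRAM SelfBalancing

/-- Doubles the number in cell `2` until it exceeds `n`, and counts the doublings in the real
cell `5`. -/
def doublingLoop : Program :=
  .loop (.natLe (.reg 2) (.reg 0))
    (.seq (.setNat (.lit 2) (.add (.reg 2) (.reg 2)))
      (.setReal (.lit 5) (.add (.reg 5) (.const 1))))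

/-- The real cell `5` holds the parameter of the walk, the cells `2` and `3` hold its position, and
the cell `4` the random real of the current round. -/
def balancing : Algorithm where
  setup :=
    .seq (.setNat (.lit 2) (.lit 1))
      (.seq doublingLoop
        (.setReal (.lit 5) (.add (.mul (.reg 5) (.reg 5)) (.const 2))))
  round :=
    .seq (.draw (.lit 4))
      (.ite
        (.realLe (.mul (.mul (.const 2) (.reg 5)) (.reg 4))
          (.sub (.reg 5) (.add (.mul (.reg 2) (.reg 0)) (.mul (.reg 3) (.reg 1)))))
        (.seq (.setNat (.lit 1) (.lit 1))
          (.seq (.setReal (.lit 2) (.add (.reg 2) (.reg 0)))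
            (.setReal (.lit 3) (.add (.reg 3) (.reg 1)))))
        (.seq (.setNat (.lit 1) (.lit 0))
          (.seq (.setReal (.lit 2) (.sub (.reg 2) (.reg 0)))
            (.setReal (.lit 3) (.sub (.reg 3) (.reg 1))))))

/-- The parameter of the walk: the square of the binary length of `n`, plus `2`. -/
noncomputable def scale (n : ℕ) : ℝ := (n.size : ℝ) * n.size + 2

/-- Induction on the number `d` of doublings still to come. Each costs a test and two assignments,
and the last, failing test costs one more step. -/
theorem exec_doublingLoop (D : Fin 2 → Measure ℝ) (ω : ℕ → unitInterval) {n : ℕ} (d : ℕ) :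
    ∀ {i : ℕ} {s : State}, i + d = n.size → s.nats 0 = n → s.nats 2 = 2 ^ i → s.reals 5 = i →
      ∃ s', Exec D ω doublingLoop s (3 * d + 1) s' ∧ s'.reals 5 = n.size ∧
        s'.reals 2 = s.reals 2 ∧ s'.reals 3 = s.reals 3 ∧ s'.draws = s.draws := by
  induction d with
  | zero =>
    intro i s hi h0 h2 h5
    refine ⟨s, Exec.loop_done ?_, by rw [h5, ← hi, add_zero], rfl, rfl, rfl⟩
    simpa [Test.Holds, NatExpr.eval, h0, h2, hi.symm] using Nat.size_le.mp hi.ge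
  | succ d ih =>
    intro i s hi h0 h2 h5
    have hb : (Test.natLe (.reg 2) (.reg 0)).Holds D s := by
      simpa [Test.Holds, NatExpr.eval, h0, h2] using Nat.lt_size.mp (by omega : i < n.size)
    obtain ⟨s', he, h5', h2', h3', hd'⟩ := @ih (i + 1)
      { s with
        nats := Function.update s.nats 2 (s.nats 2 + s.nats 2)
        reals := Function.update s.reals 5 (s.reals 5 + 1) }
      (by omega) (by simpa using h0) (by simp [h2]; ring) (by simp [h5])
    refine ⟨s', ?_, h5', by simpa using h2', by simpa using h3', hd'⟩
    have hbody := Exec.seq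
      (Exec.setNat (D := D) (ω := ω) (.lit 2) (.add (.reg 2) (.reg 2)) s)
      (Exec.setReal (.lit 5) (.add (.reg 5) (.const 1)) _)
    have hrun : Exec D ω doublingLoop s (1 + 1 + (3 * d + 1) + 1) s' :=
      Exec.loop_next hb hbody
        (by simpa [NatExpr.eval, RealExpr.eval, doublingLoop] using he)
    convert hrun using 1
    ring

theorem exec_setup (D : Fin 2 → Measure ℝ) (ω : ℕ → unitInterval) (n : ℕ) :
    ∃ s, Exec D ω balancing.setup (startState n) (3 * n.size + 3) s ∧
      s.reals 5 = scale n ∧ (s.reals 2, s.reals 3) = 0 ∧ s.draws = 0 := by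
  obtain ⟨s, he, h5, h2, h3, hd⟩ := exec_doublingLoop D ω (n := n) n.size (i := 0)
    (s := { startState n with nats := Function.update (startState n).nats 2 1 })
    (zero_add _) (by simp [startState]) (by simp) (by simp [startState])
  have hrun := Exec.seq (Exec.setNat (D := D) (ω := ω) (.lit 2) (.lit 1) (startState n))
    (Exec.seq he (Exec.setReal (.lit 5) (.add (.mul (.reg 5) (.reg 5)) (.const 2)) s))
  rw [show 1 + (3 * n.size + 1 + 1) = 3 * n.size + 3 by ring] at hrun
  refine ⟨_, hrun, ?_, ?_, ?_⟩
  · simp [NatExpr.eval, RealExpr.eval, h5, scale]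
  · simpa [NatExpr.eval, h2, h3] using ⟨rfl, rfl⟩
  · exact hd

theorem exec_round (D : Fin 2 → Measure ℝ) (ω : ℕ → unitInterval) (s : State) (x : Fin 2 → ℝ) :
    ∃ s', Exec D ω balancing.round (present s x) 5 s' ∧ s'.reals 5 = s.reals 5 ∧
      (s'.reals 2, s'.reals 3) =
        step (s.reals 5) (s.reals 2, s.reals 3) (x 0, x 1) (ω s.draws) ∧
      s'.draws = s.draws + 1 ∧
      (s'.nats 1 ≠ 0 ↔ 2 * s.reals 5 * ω s.draws ≤
        s.reals 5 - dot (s.reals 2, s.reals 3) (x 0, x 1)) := by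
  have hdraw := Exec.draw (D := D) (ω := ω) (.lit 4) (present s x)
  by_cases h : 2 * s.reals 5 * ω s.draws ≤ s.reals 5 - dot (s.reals 2, s.reals 3) (x 0, x 1)
  · refine ⟨_, Exec.seq hdraw (Exec.ite_true ?_ (Exec.seq (Exec.setNat _ _ _)
      (Exec.seq (Exec.setReal _ _ _) (Exec.setReal _ _ _)))), ?_, ?_, ?_, ?_⟩
    · simpa [Test.Holds, NatExpr.eval, RealExpr.eval, present, dot, Function.update_apply] using h
    · simp [NatExpr.eval, RealExpr.eval, present]
    · simp [NatExpr.eval, RealExpr.eval, present, step, h]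
    · rfl
    · simp [NatExpr.eval, h]
  · refine ⟨_, Exec.seq hdraw (Exec.ite_false ?_ (Exec.seq (Exec.setNat _ _ _)
      (Exec.seq (Exec.setReal _ _ _) (Exec.setReal _ _ _)))), ?_, ?_, ?_, ?_⟩
    · simpa [Test.Holds, NatExpr.eval, RealExpr.eval, present, dot, Function.update_apply] using h
    · simp [NatExpr.eval, RealExpr.eval, present]
    · simp [NatExpr.eval, RealExpr.eval, present, step, h]
    · rfl
    · simpa [NatExpr.eval] using h

/-- The increments of the walk: the items as points of the plane, followed by zeros. -/
def increments {n : ℕ} (v : Fin n → Fin 2 → ℝ) (j : ℕ) : ℝ × ℝ :=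
  if h : j < n then (v ⟨j, h⟩ 0, v ⟨j, h⟩ 1) else 0

theorem increments_coe {n : ℕ} (v : Fin n → Fin 2 → ℝ) (j : Fin n) :
    increments v j = (v j 0, v j 1) := by
  simp [increments]

/-- The signed sum of the first `j` items, where the items of `S` count positively. -/
noncomputable def signedSum {n : ℕ} (v : Fin n → Fin 2 → ℝ) (S : Finset (Fin n)) (j : ℕ)
    (p : Fin 2) : ℝ :=
  ∑ i : Fin n, if (i : ℕ) < j then (if i ∈ S then v i p else -v i p) else 0

/-- The sets before and after a round differ at most in item `j`, so earlier signs are unchanged. -/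
theorem signedSum_succ {n : ℕ} (v : Fin n → Fin 2 → ℝ) {S T : Finset (Fin n)} (j : Fin n)
    (p : Fin 2) (h : ∀ i < j, i ∈ T ↔ i ∈ S) :
    signedSum v T (j + 1) p = signedSum v S j p + if j ∈ T then v j p else -v j p := by
  have hj : (if j ∈ T then v j p else -v j p) =
      ∑ i, if i = j then (if i ∈ T then v i p else -v i p) else 0 := by simp
  rw [signedSum, signedSum, hj, ← Finset.sum_add_distrib]
  refine Finset.sum_congr rfl fun i _ => ?_
  rcases lt_trichotomy i j with hij | rfl | hij
  · have h' : (i : ℕ) < j := hij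
    simp [h', hij.ne, h i hij, Nat.lt_succ_of_lt h']
  · simp
  · have h' : (j : ℕ) < i := hij
    simp [show ¬ (i : ℕ) < j + 1 by omega, show ¬ (i : ℕ) < j by omega, hij.ne']

theorem signedSum_self {n : ℕ} (v : Fin n → Fin 2 → ℝ) (S : Finset (Fin n)) (p : Fin 2) :
    signedSum v S n p = ∑ i ∈ S, v i p - ∑ i ∈ Sᶜ, v i p := by
  simp only [signedSum, Fin.is_lt, if_true]
  rw [← Finset.sum_add_sum_compl S, sub_eq_add_neg, ← Finset.sum_neg_distrib]
  congr 1
  · exact Finset.sum_congr rfl fun i hi => by simp [hi]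
  · exact Finset.sum_congr rfl fun i hi => by simp [Finset.mem_compl.mp hi]

theorem envy_eq {n : ℕ} (v : Fin n → Fin 2 → ℝ) (S : Finset (Fin n)) :
    envy v S = max (-signedSum v S n 0) (signedSum v S n 1) := by
  rw [envy, signedSum_self, signedSum_self, neg_sub]

/-- The invariant of the run of the algorithm. -/
structure Invariant (ω : ℕ → unitInterval) {n : ℕ} (v : Fin n → Fin 2 → ℝ) (j : ℕ) (s : State)
    (S : Finset (Fin n)) : Prop where
  scale_eq : s.reals 5 = scale n
  position_eq : (s.reals 2, s.reals 3) = walk (scale n) (increments v) ω j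
  draws_eq : s.draws = j
  lt_of_mem : ∀ i ∈ S, (i : ℕ) < j
  signedSum_eq : (signedSum v S j 0, signedSum v S j 1) = walk (scale n) (increments v) ω j

theorem Invariant.next {D : Fin 2 → Measure ℝ} {ω : ℕ → unitInterval} {n : ℕ}
    {v : Fin n → Fin 2 → ℝ} {j : Fin n} {s s' : State} {S : Finset (Fin n)} {t : ℕ}
    (h : Invariant ω v j s S) (he : Exec D ω balancing.round (present s (v j)) t s') :
    Invariant ω v (j + 1) s' (if s'.nats 1 ≠ 0 then insert j S else S) ∧ t = 5 := by
  obtain ⟨s'', he', h5, hpos, hd, hout⟩ := exec_round D ω s (v j)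
  obtain ⟨rfl, rfl⟩ := Exec.deterministic he he'
  have hw : walk (scale n) (increments v) ω (j + 1) = (s'.reals 2, s'.reals 3) := by
    rw [hpos, h.scale_eq, h.position_eq, h.draws_eq, walk, increments_coe]
  -- Hence an item that is not inserted counts negatively, matching the subtracted increment.
  have hjS : j ∉ S := fun hj => lt_irrefl _ (h.lt_of_mem j hj)
  have hagree : ∀ i < j, i ∈ (if s'.nats 1 ≠ 0 then insert j S else S) ↔ i ∈ S := by
    intro i hi
    split_ifs <;> simp [hi.ne]
  refine ⟨⟨h5.trans h.scale_eq, hw.symm, by rw [hd, h.draws_eq], ?_, ?_⟩, rfl⟩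
  · intro i hi
    by_cases hij : i = j
    · rw [hij]; exact Nat.lt_succ_self _
    · have : i ∈ S := by split_ifs at hi <;> simp_all
      exact Nat.lt_succ_of_lt (h.lt_of_mem i this)
  · rw [signedSum_succ v j 0 hagree, signedSum_succ v j 1 hagree, hw, hpos]
    have hsum := h.signedSum_eq
    rw [← h.position_eq, Prod.mk.injEq] at hsum
    by_cases hc : s'.nats 1 ≠ 0
    · have := hout.mp hc
      simp [hc, step, this, hsum.1, hsum.2]
    · have := mt hout.mpr hc
      rw [step, if_neg this, if_neg hc, if_neg hjS, if_neg hjS, hsum.1, hsum.2]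
      rfl

theorem reaches_invariant {D : Fin 2 → Measure ℝ} {ω : ℕ → unitInterval} {n : ℕ}
    {v : Fin n → Fin 2 → ℝ} {j : ℕ} {s : State} {S : Finset (Fin n)} {t : ℕ}
    (h : balancing.Reaches D ω v j s S t) :
    Invariant ω v j s S ∧ t = 3 * n.size + 3 + 5 * j := by
  induction h with
  | start h =>
    obtain ⟨s', he, h5, hpos, hd⟩ := exec_setup D ω n
    obtain ⟨rfl, rfl⟩ := Exec.deterministic h he
    refine ⟨⟨h5, hpos, hd, by simp, ?_⟩, rfl⟩
    simp [signedSum, walk]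
  | next j _ h' ih =>
    obtain ⟨hinv, rfl⟩ := ih
    obtain ⟨hinv', rfl⟩ := hinv.next h'
    exact ⟨hinv', by ring⟩

theorem exists_reaches (D : Fin 2 → Measure ℝ) (ω : ℕ → unitInterval) {n : ℕ}
    (v : Fin n → Fin 2 → ℝ) {j : ℕ} (hj : j ≤ n) : ∃ s S t, balancing.Reaches D ω v j s S t := by
  induction j with
  | zero =>
    obtain ⟨s, he, -⟩ := exec_setup D ω n
    exact ⟨s, ∅, _, .start he⟩
  | succ j ih =>
    obtain ⟨s, S, t, h⟩ := ih (by omega)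
    obtain ⟨s', he, -⟩ := exec_round D ω s (v ⟨j, hj⟩)
    exact ⟨s', _, _, .next ⟨j, hj⟩ h he⟩

theorem size_le_self (n : ℕ) : n.size ≤ n := Nat.size_le.mpr Nat.lt_two_pow_self

theorem exists_allocates (D : Fin 2 → Measure ℝ) (ω : ℕ → unitInterval) {n : ℕ}
    (v : Fin n → Fin 2 → ℝ) : ∃ S t, balancing.Allocates D ω v S t ∧ t ≤ 8 * n + 3 := by
  obtain ⟨s, S, t, h⟩ := exists_reaches D ω v le_rfl
  refine ⟨S, t, ⟨s, h⟩, ?_⟩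
  have := (reaches_invariant h).2
  have := size_le_self n
  omega

theorem Algorithm.Allocates.envy_le_walk {D : Fin 2 → Measure ℝ} {ω : ℕ → unitInterval} {n : ℕ}
    {v : Fin n → Fin 2 → ℝ} {S : Finset (Fin n)} {t : ℕ} (h : balancing.Allocates D ω v S t) :
    envy v S ≤ max |(walk (scale n) (increments v) ω n).1|
      |(walk (scale n) (increments v) ω n).2| := by
  obtain ⟨s, hs⟩ := h
  rw [envy_eq, ← (reaches_invariant hs).1.signedSum_eq]
  exact max_le_max (neg_le_abs _) (le_abs_self _)

theorem envy_le_card {n : ℕ} {v : Fin n → Fin 2 → ℝ} (hv : ∀ j p, v j p ∈ Set.Icc (0 : ℝ) 1)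
    (S : Finset (Fin n)) : envy v S ≤ n := by
  have hbound : ∀ (T U : Finset (Fin n)) p, ∑ j ∈ T, v j p - ∑ j ∈ U, v j p ≤ n := by
    intro T U p
    have h₁ : ∑ j ∈ T, v j p ≤ ∑ _j ∈ T, (1 : ℝ) := Finset.sum_le_sum fun j _ => (hv j p).2
    have h₂ : 0 ≤ ∑ j ∈ U, v j p := Finset.sum_nonneg fun j _ => (hv j p).1
    have h₃ : (T.card : ℝ) ≤ n := by exact_mod_cast T.card_le_univ.trans (Fintype.card_fin n).le
    simp only [Finset.sum_const, nsmul_eq_mul, mul_one] at h₁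
    linarith
  exact max_le (hbound _ _ _) (hbound _ _ _)

/-! ### The probability of a large envy -/

theorem two_le_scale (n : ℕ) : 2 ≤ scale n := by
  unfold scale
  nlinarith [mul_self_nonneg (n.size : ℝ)]

theorem log_sq_le_scale {n : ℕ} (hn : 1 ≤ n) : Real.log n ^ 2 ≤ scale n := by
  have hn' : (1 : ℝ) ≤ n := by exact_mod_cast hn
  have h₀ : 0 ≤ Real.log n := Real.log_nonneg hn'
  have h : Real.log n ≤ n.size := by
    have h₁ : (n : ℝ) ≤ 2 ^ n.size := by exact_mod_cast n.lt_size_self.le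
    have h₂ := Real.log_le_log (by linarith) h₁
    rw [Real.log_pow] at h₂
    have h₃ : Real.log 2 ≤ 1 := by linarith [Real.log_two_lt_d9]
    nlinarith [Nat.cast_nonneg (α := ℝ) n.size]
  unfold scale
  nlinarith

theorem one_lt_log {n : ℕ} (hn : 3 ≤ n) : 1 < Real.log n := by
  have hn' : (3 : ℝ) ≤ n := by exact_mod_cast hn
  rw [Real.lt_log_iff_exp_lt (by linarith)]
  linarith [Real.exp_one_lt_d9]

/-- As `log n > 1`, one has `(2 log n + 1)² + 2 ≤ 9 log² n + 2 log² n`. -/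
theorem scale_le_log_sq {n : ℕ} (hn : 3 ≤ n) : scale n ≤ 11 * Real.log n ^ 2 := by
  have hlog := one_lt_log hn
  have h : (n.size : ℝ) ≤ 2 * Real.log n + 1 := by
    have hpos : 0 < n.size := Nat.size_pos.mpr (by omega)
    have h₁ : (2 : ℝ) ^ (n.size - 1) ≤ n := by
      exact_mod_cast Nat.lt_size.mp (by omega : n.size - 1 < n.size)
    have h₂ := Real.log_le_log (by positivity) h₁
    rw [Real.log_pow, Nat.cast_sub hpos, Nat.cast_one] at h₂
    have h₃ : 1 / 2 ≤ Real.log 2 := by linarith [Real.log_two_gt_d9]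
    have h₄ : (1 : ℝ) ≤ n.size := by exact_mod_cast hpos
    nlinarith
  have h₀ : (0 : ℝ) ≤ n.size := Nat.cast_nonneg _
  unfold scale
  nlinarith

/-- With `y = log n`, taking logarithms reduces this to `log² y ≤ 4y`, which follows from `log √y ≤
√y - 1`. -/
theorem log_sq_le_rpow {n : ℕ} (hn : 3 ≤ n) :
    Real.log n ^ 2 ≤ (n : ℝ) ^ (8 / Real.log (Real.log n)) := by
  have hlog := one_lt_log hn
  have hn₀ : (0 : ℝ) < n := by exact_mod_cast (by omega : 0 < n)
  set y := Real.log n with hy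
  have hy₀ : 0 < y := by linarith
  have hl : 0 < Real.log y := Real.log_pos hlog
  have hsqrt : Real.log y ≤ 2 * √y := by
    have h := Real.log_le_sub_one_of_pos (Real.sqrt_pos.mpr hy₀)
    rw [Real.log_sqrt hy₀.le] at h
    linarith
  have hsq : Real.log y ^ 2 ≤ 4 * y := by
    nlinarith [Real.sq_sqrt hy₀.le, Real.sqrt_nonneg y]
  calc y ^ 2 = Real.exp (2 * Real.log y) := by
        rw [two_mul, Real.exp_add, Real.exp_log hy₀, sq]
    _ ≤ Real.exp (y * (8 / Real.log y)) := by
        rw [Real.exp_le_exp, ← mul_div_assoc, le_div_iff₀ hl]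
        nlinarith
    _ = _ := by rw [Real.rpow_def_of_pos hn₀]

/-- Here `scale n ≥ log² n ≥ 4 (k + 3) log n`. The three spare powers of `n` absorb `2n + 4 ≤ n³`.
-/
theorem failure_bound {n k : ℕ} (hn : 3 ≤ n) (hk : 4 * (k + 3) ≤ Real.log n) :
    (2 * n + 4) * Real.exp (-scale n / 4) ≤ 1 / (n : ℝ) ^ k := by
  have hn' : (3 : ℝ) ≤ n := by exact_mod_cast hn
  have hlog := one_lt_log hn
  have hscale := log_sq_le_scale (n := n) (by omega)
  have hexp : Real.exp (-scale n / 4) ≤ 1 / (n : ℝ) ^ (k + 3) := by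
    have : -scale n / 4 ≤ -((k + 3 : ℕ) * Real.log n) := by
      push_cast
      nlinarith
    refine (Real.exp_le_exp.mpr this).trans (le_of_eq ?_)
    rw [Real.exp_neg, ← Real.log_pow, Real.exp_log (by positivity), one_div]
  calc (2 * n + 4) * Real.exp (-scale n / 4) ≤ (n : ℝ) ^ 3 * (1 / (n : ℝ) ^ (k + 3)) := by
        refine mul_le_mul ?_ hexp (Real.exp_pos _).le (by positivity)
        nlinarith [mul_self_nonneg ((n : ℝ) - 3), pow_pos (by linarith : (0 : ℝ) < n) 2]
    _ = _ := by
        rw [pow_add]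
        field_simp

theorem ae_mem_Icc (D : Fin 2 → Measure ℝ) [∀ i, IsProbabilityMeasure (D i)]
    (hD : ∀ i, D i (Set.Icc 0 1) = 1) (n : ℕ) :
    ∀ᵐ v ∂(Measure.pi fun _ : Fin n => Measure.pi D), ∀ j p, v j p ∈ Set.Icc (0 : ℝ) 1 := by
  have h : ∀ p, ∀ᵐ y ∂(D p), y ∈ Set.Icc (0 : ℝ) 1 := fun p =>
    (prob_compl_eq_zero_iff measurableSet_Icc).mpr (hD p)
  rw [ae_all_iff]
  intro j
  have h₁ : ∀ᵐ x ∂(Measure.pi D), ∀ p, x p ∈ Set.Icc (0 : ℝ) 1 :=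
    ae_all_iff.mpr fun p => (Measure.quasiMeasurePreserving_eval D p).ae (h p)
  exact (Measure.quasiMeasurePreserving_eval (fun _ : Fin n => Measure.pi D) j).ae h₁

theorem dot_increments_le {n : ℕ} {v : Fin n → Fin 2 → ℝ}
    (hv : ∀ j p, v j p ∈ Set.Icc (0 : ℝ) 1) (j : ℕ) :
    dot (increments v j) (increments v j) ≤ 2 := by
  unfold increments
  split_ifs with h
  · have h₀ := hv ⟨j, h⟩ 0
    have h₁ := hv ⟨j, h⟩ 1
    simp only [dot]
    nlinarith [h₀.1, h₀.2, h₁.1, h₁.2]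
  · simp [dot]

theorem measurableSet_walk_large (c : ℝ) (n : ℕ) :
    MeasurableSet {x : (Fin n → Fin 2 → ℝ) × (ℕ → unitInterval) |
      c < max |(walk c (increments x.1) x.2 n).1| |(walk c (increments x.1) x.2 n).2|} := by
  have hw : Measurable fun x : (Fin n → Fin 2 → ℝ) × (ℕ → unitInterval) =>
      walk c (increments x.1) x.2 n := by
    refine measurable_walk (x := fun x : (Fin n → Fin 2 → ℝ) × (ℕ → unitInterval) =>
      increments x.1) (ω := fun x => x.2) c (fun i => ?_)
      (fun i => (measurable_pi_apply i).comp measurable_snd) n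
    unfold increments
    split_ifs <;> fun_prop
  exact measurableSet_lt measurable_const
    ((continuous_abs.measurable.comp hw.fst).max (continuous_abs.measurable.comp hw.snd))

theorem law_walk_large_le (D : Fin 2 → Measure ℝ) [∀ i, IsProbabilityMeasure (D i)]
    (hD : ∀ i, D i (Set.Icc 0 1) = 1) {c : ℝ} (hc : 2 ≤ c) (n : ℕ) :
    law D n {x | c < max |(walk c (increments x.1) x.2 n).1| |(walk c (increments x.1) x.2 n).2|} ≤
      (2 * n + 4) * ENNReal.ofReal (Real.exp (-c / 4)) := by
  rw [law, Measure.prod_apply (measurableSet_walk_large c n)]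
  refine (lintegral_mono_ae (g := fun _ => (2 * n + 4) * ENNReal.ofReal (Real.exp (-c / 4)))
    ?_).trans (by simp)
  -- By Fubini the tail bound is applied for almost every fixed `v`.
  filter_upwards [ae_mem_Icc D hD n] with v hv
  exact measure_walk_large_le hc (dot_increments_le hv) n

theorem law_card_lt_envy (D : Fin 2 → Measure ℝ) [∀ i, IsProbabilityMeasure (D i)]
    (hD : ∀ i, D i (Set.Icc 0 1) = 1) (n : ℕ) :
    law D n {x | ∃ S, (n : ℝ) < envy x.1 S} = 0 := by
  have h : ∀ᵐ x ∂law D n, ∀ j p, x.1 j p ∈ Set.Icc (0 : ℝ) 1 :=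
    Measure.quasiMeasurePreserving_fst.ae (ae_mem_Icc D hD n)
  refine measure_mono_null ?_ (ae_iff.mp h)
  rintro x ⟨S, hS⟩ hx
  exact hS.not_ge (envy_le_card hx S)

/-- The case split is at `log n = 4 (k + 3)`: above it the walk is bounded by `scale n`, below it
`n` itself is at most `exp (4 (k + 3))`. Only monotonicity of the measure is applied to the envy
event, so its measurability is not needed. -/
theorem law_envy_large_le {n k : ℕ} (hn : 3 ≤ n) (D : Fin 2 → Measure ℝ)
    [∀ i, IsProbabilityMeasure (D i)] (hD : ∀ i, D i (Set.Icc 0 1) = 1) :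
    law D n {x | ∃ (S : Finset (Fin n)) (t : ℕ), balancing.Allocates D x.2 x.1 S t ∧
      max 11 (Real.exp (4 * (k + 3))) * (n : ℝ) ^ (8 / Real.log (Real.log n)) < envy x.1 S} ≤
        ENNReal.ofReal (1 / (n : ℝ) ^ k) := by
  have hlog := one_lt_log hn
  have hn₀ : (0 : ℝ) < n := by exact_mod_cast (by omega : 0 < n)
  have hsq := log_sq_le_rpow hn
  have hone : (1 : ℝ) ≤ (n : ℝ) ^ (8 / Real.log (Real.log n)) := by nlinarith
  rcases le_or_gt (4 * ((k : ℝ) + 3)) (Real.log n) with hk | hk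
  · have hle : scale n ≤
        max 11 (Real.exp (4 * (k + 3))) * (n : ℝ) ^ (8 / Real.log (Real.log n)) :=
      (scale_le_log_sq hn).trans (mul_le_mul (le_max_left _ _) hsq (sq_nonneg _) (by positivity))
    refine (measure_mono ?_).trans ((law_walk_large_le D hD (two_le_scale n) n).trans ?_)
    · rintro x ⟨S, t, hA, hS⟩
      exact hle.trans_lt (hS.trans_le hA.envy_le_walk)
    · refine le_trans (le_of_eq ?_) (ENNReal.ofReal_le_ofReal (failure_bound hn hk))
      rw [ENNReal.ofReal_mul (by positivity), ENNReal.ofReal_add (by positivity) (by norm_num),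
        ENNReal.ofReal_mul (by norm_num), ENNReal.ofReal_natCast]
      norm_num
  · have hle : (n : ℝ) ≤
        max 11 (Real.exp (4 * (k + 3))) * (n : ℝ) ^ (8 / Real.log (Real.log n)) := by
      have h : (n : ℝ) ≤ Real.exp (4 * (k + 3)) := ((Real.log_lt_iff_lt_exp hn₀).mp hk).le
      have h' := h.trans (le_max_right 11 _)
      nlinarith
    refine (measure_mono ?_).trans ((law_card_lt_envy D hD n).le.trans zero_le)
    rintro x ⟨S, t, -, hS⟩
    exact ⟨S, hle.trans_lt hS⟩

end OnlineEnvy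

theorem theorem3 :
    ∃ A : OnlineEnvy.Algorithm,
      (∃ p : Polynomial ℕ, ∀ (n : ℕ) (D : Fin 2 → MeasureTheory.Measure ℝ)
        (_ : ∀ i, MeasureTheory.IsProbabilityMeasure (D i)) (_ : ∀ i, D i (Set.Icc 0 1) = 1)
        (v : Fin n → Fin 2 → ℝ) (ω : ℕ → unitInterval),
        ∃ (S : Finset (Fin n)) (t : ℕ), A.Allocates D ω v S t ∧ t ≤ p.eval n) ∧
      ∀ k : ℕ, ∃ c C : ℝ, ∀ n : ℕ, 3 ≤ n → ∀ (D : Fin 2 → MeasureTheory.Measure ℝ)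
        (_ : ∀ i, MeasureTheory.IsProbabilityMeasure (D i)) (_ : ∀ i, D i (Set.Icc 0 1) = 1),
        OnlineEnvy.law D n
          {x | ∃ (S : Finset (Fin n)) (t : ℕ), A.Allocates D x.2 x.1 S t ∧
            C * (n : ℝ) ^ (c / Real.log (Real.log n)) < OnlineEnvy.envy x.1 S} ≤
          ENNReal.ofReal (1 / (n : ℝ) ^ k) := by
  refine ⟨OnlineEnvy.balancing, ⟨8 * Polynomial.X + 3, fun n D _ _ v ω => ?_⟩, fun k =>
    ⟨8, max 11 (Real.exp (4 * (k + 3))), fun n hn D _ hD =>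
      OnlineEnvy.law_envy_large_le hn D hD⟩⟩
  simpa using OnlineEnvy.exists_allocates D ω v
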